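/- Consider a mono-static pulsed radar with pulse duration $T>0$, duty cycle $\delta\in(0,1]$, total bandwidth $B>0$ of which the fraction $\beta\in(0,1]$ is used for integrated sensing and communication, transmit power $P_{BS}>0$, carrier wavelength $\lambda>0$, target cross section $\sigma_{RCS}>0$, target distance $d>0$, path loss exponent $\alpha_r>0$, spectral-shape constant $\gamma>0$ (with $\gamma^2=(2\pi)^2/12$ for a flat spectrum), standard deviation $\sigma_\tau>0$ of the time-delay fluctuation, and noise power $\sigma^2=k_BT_{temp}\beta B$, where $k_B>0$ is Boltzmann's constant and $T_{temp}>0$ the absolute temperature. Put $C_r=\sigma_{RCS}\lambda^2/(4\pi)^3$. The downlink and uplink channel coefficients $h_{r,d},h_{r,u}$ are Nakagami-$m$ ($m>0$ real) with independent power gains: $|h_{r,d}|^2$ and $|h_{r,u}|^2$ are independent with the common density $\frac{m^m}{\Gamma(m)}x^{m-1}e^{-mx}$, $x>0$. With perfect interference cancellation the echo SNR is $$\gamma_r^{echo}=\frac{P_{BS}C_rd^{-\alpha_r}|h_{r,d}|^2|h_{r,u}|^2\gamma^2\beta^2B^2\sigma_\tau^2}{\sigma^2},$$ and the ergodic radar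 estimation information rate (the mean of the upper bound that characterizes this rate) is $$R=\mathbb E\left[\frac{\delta}{2T}\log_2\left(1+2T\beta B\gamma_r^{echo}\right)\right].$$ Let $\Xi_{r,1}=2T\beta B\cdot\frac{P_{BS}C_r\gamma^2\beta^2B^2\sigma_\tau^2}{\sigma^2}$, so that $2T\beta B\gamma_r^{echo}=\Xi_{r,1}d^{-\alpha_r}|h_{r,d}|^2|h_{r,u}|^2$. Then the expectation is finite, the integral below converges absolutely, and $$R=\frac{\delta}{2T\ln 2}\int_0^\infty\frac{1}{z+1}\left(1-\frac{1}{\Gamma(m)^2}\,G^{2,1}_{1,3}\left(\frac{m^2d^{\alpha_r}}{\Xi_{r,1}}z\;\middle|\;{1\atop m,m,0}\right)\right)dz,$$ where $G^{2,1}_{1,3}$ is the Meijer G function, $$G^{2,1}_{1,3}\left(x\;\middle|\;{1\atop m,m,0}\right)=\frac1{2\pi i}\int_{\sigma_0-i\infty}^{\sigma_0+i\infty}\frac{\Gamma(m-s)^2\,\Gamma(s)}{\Gamma(1+s)}\,x^s\,ds,\qquad 0<\sigma_0<m .$$ -/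

import Mathlib

open MeasureTheory ProbabilityTheory

/-- The vertical line `Re s = σ` separates the poles of the factors `Γ(b - s)`, `b ∈ b₁`
(which lie at `b, b + 1, b + 2, …`), from the poles of the factors `Γ(1 - a + s)`, `a ∈ a₁`
(which lie at `a - 1, a - 2, …`). -/
def MeijerSeparates (a₁ b₁ : List ℂ) (σ : ℝ) : Prop :=
  (∀ a ∈ a₁, a.re - 1 < σ) ∧ (∀ b ∈ b₁, σ < b.re)

/-- The Mellin–Barnes kernel of the Meijer G function
`∏ Γ(b - s) (b ∈ b₁) · ∏ Γ(1 - a + s) (a ∈ a₁) /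
  (∏ Γ(1 - b + s) (b ∈ b₂) · ∏ Γ(a - s) (a ∈ a₂))`. -/
noncomputable def meijerKernel (a₁ a₂ b₁ b₂ : List ℂ) (s : ℂ) : ℂ :=
  ((b₁.map fun b => Complex.Gamma (b - s)).prod *
      (a₁.map fun a => Complex.Gamma (1 - a + s)).prod) /
    ((b₂.map fun b => Complex.Gamma (1 - b + s)).prod *
      (a₂.map fun a => Complex.Gamma (a - s)).prod)

open Classical in
/-- The Meijer G function `G^{m,n}_{p,q}(z | a₁, a₂; b₁, b₂)`, where `a₁` holds the first `n`
upper parameters, `a₂` the remaining `p - n`, `b₁` the first `m` lower parameters and `b₂` the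
remaining `q - m`. It is the Mellin–Barnes integral `(1 / (2πi)) ∫_L kernel(s) z ^ s ds`, the
contour `L` being a vertical line directed upwards that separates the two families of poles
(along `s = σ + i t` one has `ds = i dt`, hence the factor `1 / (2π)`). By Cauchy's theorem the
value does not depend on the separating line, if the kernel decays along vertical lines.
The value `0` is assigned when no vertical line separates the poles. -/
noncomputable def meijerG (a₁ a₂ b₁ b₂ : List ℂ) (z : ℂ) : ℂ :=
  if h : ∃ σ : ℝ, MeijerSeparates a₁ b₁ σ then
    (1 / (2 * (Real.pi : ℂ))) *
      ∫ t : ℝ, meijerKernel a₁ a₂ b₁ b₂ ((h.choose : ℂ) + t * Complex.I) *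
        z ^ ((h.choose : ℂ) + t * Complex.I)
  else 0

/-- The deterministic parameters of the radar link of the network. -/
structure RadarSystem where
  /-- radar pulse duration -/
  T : ℝ
  /-- duty cycle of the radar -/
  δ : ℝ
  /-- total bandwidth -/
  B : ℝ
  /-- fraction of the bandwidth used for integrated sensing and communication -/
  β : ℝ
  /-- transmit power of the base station -/
  PBS : ℝ
  /-- radar cross section of the target -/
  σRCS : ℝ
  /-- wavelength of the carrier -/
  wavelength : ℝ
  /-- distance between the base station and the radar target -/
  d : ℝ
  /-- path loss exponent of the radar echoes -/
  α : ℝ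
  /-- spectral-shape constant (its square is `(2π)² / 12` for a flat spectrum) -/
  γ : ℝ
  /-- standard deviation of the time-delay fluctuation -/
  στ : ℝ
  /-- Boltzmann constant -/
  kB : ℝ
  /-- absolute temperature -/
  Temp : ℝ
  T_pos : 0 < T
  δ_pos : 0 < δ
  δ_le : δ ≤ 1
  B_pos : 0 < B
  β_pos : 0 < β
  β_le : β ≤ 1
  PBS_pos : 0 < PBS
  σRCS_pos : 0 < σRCS
  wavelength_pos : 0 < wavelength
  d_pos : 0 < d
  α_pos : 0 < α
  γ_pos : 0 < γ
  στ_pos : 0 < στ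
  kB_pos : 0 < kB
  Temp_pos : 0 < Temp

namespace RadarSystem

/-- The reference-distance intercept `C_r = σ_RCS λ² / (4π)³`. -/
noncomputable def Cr (S : RadarSystem) : ℝ :=
  S.σRCS * S.wavelength ^ 2 / (4 * Real.pi) ^ 3

/-- The path loss `C_r d ^ (-α_r)` of the radar echoes. -/
noncomputable def pathLoss (S : RadarSystem) : ℝ := S.Cr * S.d ^ (-S.α)

/-- The noise power `k_B T_temp β B`. -/
noncomputable def noisePower (S : RadarSystem) : ℝ := S.kB * S.Temp * (S.β * S.B)

/-- The SNR of the radar echo (under perfect interference cancellation) when the downlink and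
uplink channel coefficients are `hd` and `hu`. -/
noncomputable def echoSNR (S : RadarSystem) (hd hu : ℂ) : ℝ :=
  S.PBS * S.pathLoss * ‖hd‖ ^ 2 * ‖hu‖ ^ 2 * S.γ ^ 2 * S.β ^ 2 * S.B ^ 2 * S.στ ^ 2 /
    S.noisePower

/-- The radar estimation information rate `(δ / (2T)) log₂ (1 + 2 T β B · SNR)`. -/
noncomputable def reir (S : RadarSystem) (hd hu : ℂ) : ℝ :=
  S.δ / (2 * S.T) * Real.logb 2 (1 + 2 * S.T * S.β * S.B * S.echoSNR hd hu)

/-- The ergodic radar estimation information rate, the mean of the rate over the fading. -/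
noncomputable def ergodicREIR (S : RadarSystem) {Ω : Type*} [MeasurableSpace Ω]
    (μ : Measure Ω) (hd hu : Ω → ℂ) : ℝ :=
  ∫ ω, S.reir (hd ω) (hu ω) ∂μ

/-- The deterministic coefficient `Ξ` of `2 T β B · SNR`, namely the factor for which
`2 T β B · SNR = Ξ d ^ (-α_r) |hd|² |hu|²`. -/
noncomputable def Xi (S : RadarSystem) : ℝ :=
  2 * S.T * S.β * S.B *
    (S.PBS * S.Cr * S.γ ^ 2 * S.β ^ 2 * S.B ^ 2 * S.στ ^ 2 / S.noisePower)

/-- `Ξ` is the factor announced in its description. -/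
theorem echoSNR_eq_Xi (S : RadarSystem) (hd hu : ℂ) :
    2 * S.T * S.β * S.B * S.echoSNR hd hu =
      S.Xi * S.d ^ (-S.α) * (‖hd‖ ^ 2 * ‖hu‖ ^ 2) := by
  unfold echoSNR Xi pathLoss
  ring

end RadarSystem

/-- `h` is a Nakagami-`m` fading coefficient of mean power one: the power gain `|h|²` has the
density `m ^ m / Γ(m) · x ^ (m - 1) · exp (-m x)` on `x > 0`, that is, the Gamma law of shape `m`
and rate `m`. -/
def IsNakagami {Ω : Type*} [MeasurableSpace Ω] (μ : Measure Ω) (m : ℝ) (h : Ω → ℂ) : Prop :=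
  HasLaw (fun ω => ‖h ω‖ ^ 2) (gammaMeasure m m) μ

/-! The rate is a constant times E[log(1 + cW)], where W is a product of two independent Gamma(m, m)
variables. Since log(1 + t) has derivative 1/(1 + t), the layer-cake formula turns this mean into ∫
P(cW > z)/(1 + z) dz; everything is finite because log(1 + Z) ≤ Z and E W < ∞
(`integral_log_one_add_eq_integral_tail`).

It remains to see that P(W ≤ w) is the Meijer function divided by Γ(m)². By Fubini, the Mellin
transform of x ↦ P(xW ≤ 1) is E[W^(-s)]/s (`mellin_integral_indicator`). By independence E[W^(-s)] =
(m^s Γ(m - s)/Γ(m))². Since 1/s = Γ(s)/Γ(1 + s), Mellin inversion at x = 1/w is exactly the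
Mellin–Barnes integral at m² w (`meijerG_eq_measureReal_mul_le`). Inversion needs continuity, which
holds because W has no atoms, and integrability on the contour, which follows from a quadratic decay
bound for Γ². -/

/-! ### Bounds for Γ on vertical lines -/

/-- On a vertical line in the right half-plane, `Γ` is bounded by its value at the real point. -/
theorem norm_complexGamma_le_of_re_pos {s : ℂ} (hs : 0 < s.re) :
    ‖Complex.Gamma s‖ ≤ Real.Gamma s.re := by
  rw [Complex.Gamma_eq_integral hs, Real.Gamma_eq_integral hs, Complex.GammaIntegral]
  refine (norm_integral_le_integral_norm _).trans_eq ?_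
  refine setIntegral_congr_fun measurableSet_Ioi fun x hx => ?_
  simp only [norm_mul, Complex.norm_cpow_eq_rpow_re_of_pos hx]
  rw [Complex.norm_real, Real.norm_of_nonneg (Real.exp_pos _).le]
  simp

/-- The functional equation Γ(s + 1) = s Γ(s) gains a factor 1/|s| over the crude bound; after
squaring, this decay is integrable along a vertical line. -/
theorem norm_complexGamma_le_div_norm {s : ℂ} (hs : 0 < s.re) :
    ‖Complex.Gamma s‖ ≤ Real.Gamma (s.re + 1) / ‖s‖ := by
  have h0 : s ≠ 0 := by rintro rfl; simp at hs
  rw [le_div_iff₀ (norm_pos_iff.2 h0), mul_comm, ← norm_mul, ← Complex.Gamma_add_one s h0]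
  have h1 : 0 < (s + 1).re := by simp; linarith
  simpa using norm_complexGamma_le_of_re_pos h1

theorem continuousAt_complexGamma_of_re_pos {s : ℂ} (hs : 0 < s.re) :
    ContinuousAt Complex.Gamma s := by
  refine (Complex.differentiableAt_Gamma s fun n hn => ?_).continuousAt
  rw [hn] at hs
  simp at hs
  linarith [Nat.cast_nonneg (α := ℝ) n]

/-- The Mellin transform of the distribution function of a product of two Gamma variables is
integrable along vertical lines. -/
theorem verticalIntegrable_cpow_mul_Gamma_sq_div {a r σ : ℝ} (hr : 0 < r) (hσ : 0 < σ)
    (hσa : σ < a) :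
    Complex.VerticalIntegrable
      (fun s => ((r : ℂ) ^ s * Complex.Gamma (a - s)) ^ 2 / s) σ := by
  have hre (t : ℝ) : ((a : ℂ) - (σ + t * Complex.I)).re = a - σ := by simp
  have hb : 0 < a - σ := by linarith
  have hs0 (t : ℝ) : (σ : ℂ) + t * Complex.I ≠ 0 := by
    intro h
    have := congrArg Complex.re h
    simp at this
    linarith
  -- With b = a - σ, K combines |Γ(a - s)|² ≤ Γ(b + 1)²/(b² + t²), 1/|s| ≤ 1/σ, and 1/(b² + t²) ≤ (1
  -- + 1/b²)/(1 + t²).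
  set K : ℝ := (r ^ σ * Real.Gamma (a - σ + 1)) ^ 2 * (1 + 1 / (a - σ) ^ 2) / σ
  refine (integrable_inv_one_add_sq.const_mul K).mono' ?_ (.of_forall fun t => ?_)
  · refine Continuous.aestronglyMeasurable ?_
    refine Continuous.div ?_ (by fun_prop) hs0
    refine Continuous.pow (Continuous.mul ?_ ?_) 2
    · exact Continuous.const_cpow (by fun_prop) (.inl (by exact_mod_cast hr.ne'))
    · refine continuous_iff_continuousAt.2 fun t => ?_
      exact ContinuousAt.comp (f := fun t : ℝ => (a : ℂ) - (σ + t * Complex.I))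
        (continuousAt_complexGamma_of_re_pos (by rw [hre]; exact hb))
        (by fun_prop)
  · have h1 := norm_complexGamma_le_div_norm (s := (a : ℂ) - (σ + t * Complex.I))
      (by rw [hre]; exact hb)
    rw [hre] at h1
    have h2 : ‖(a : ℂ) - (σ + t * Complex.I)‖ ^ 2 = (a - σ) ^ 2 + t ^ 2 := by
      rw [Complex.sq_norm, Complex.normSq_apply]
      simp
      ring
    have h3 : σ ≤ ‖(σ : ℂ) + t * Complex.I‖ := by
      have := Complex.re_le_norm ((σ : ℂ) + t * Complex.I)
      simpa using this
    rw [norm_div, norm_pow, norm_mul, Complex.norm_cpow_eq_rpow_re_of_pos hr]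
    simp only [Complex.add_re, Complex.ofReal_re, Complex.mul_re, Complex.I_re, mul_zero,
      Complex.ofReal_im, Complex.I_im, mul_one, sub_zero, add_zero]
    have hG : ‖Complex.Gamma ((a : ℂ) - (σ + t * Complex.I))‖ ^ 2
        ≤ Real.Gamma (a - σ + 1) ^ 2 / ((a - σ) ^ 2 + t ^ 2) := by
      rw [← h2, ← div_pow]
      exact pow_le_pow_left₀ (norm_nonneg _) h1 2
    have hden : 1 / ((a - σ) ^ 2 + t ^ 2) ≤ (1 + 1 / (a - σ) ^ 2) * (1 + t ^ 2)⁻¹ := by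
      rw [← div_eq_mul_inv, div_le_div_iff₀ (by positivity) (by positivity)]
      have : (1 + 1 / (a - σ) ^ 2) * ((a - σ) ^ 2 + t ^ 2)
          = (a - σ) ^ 2 + 1 + t ^ 2 + t ^ 2 / (a - σ) ^ 2 := by
        field_simp
        ring
      rw [this]
      have : 0 ≤ t ^ 2 / (a - σ) ^ 2 := by positivity
      nlinarith [sq_nonneg (a - σ)]
    calc (r ^ σ * ‖Complex.Gamma ((a : ℂ) - (σ + t * Complex.I))‖) ^ 2 /
          ‖(σ : ℂ) + t * Complex.I‖
        ≤ (r ^ σ * ‖Complex.Gamma ((a : ℂ) - (σ + t * Complex.I))‖) ^ 2 / σ := by gcongr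
      _ = (r ^ σ) ^ 2 * ‖Complex.Gamma ((a : ℂ) - (σ + t * Complex.I))‖ ^ 2 / σ := by
          rw [mul_pow]
      _ ≤ (r ^ σ) ^ 2 * (Real.Gamma (a - σ + 1) ^ 2 / ((a - σ) ^ 2 + t ^ 2)) / σ := by gcongr
      _ = (r ^ σ * Real.Gamma (a - σ + 1)) ^ 2 / σ * (1 / ((a - σ) ^ 2 + t ^ 2)) := by ring
      _ ≤ (r ^ σ * Real.Gamma (a - σ + 1)) ^ 2 / σ *
          ((1 + 1 / (a - σ) ^ 2) * (1 + t ^ 2)⁻¹) := by gcongr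
      _ = K * (1 + t ^ 2)⁻¹ := by simp only [K]; ring

/-! ### Complex moments of the Gamma law -/

namespace ProbabilityTheory

theorem measurable_gammaPDF (a r : ℝ) : Measurable (gammaPDF a r) :=
  (measurable_gammaPDFReal a r).ennreal_ofReal

theorem gammaPDF_toReal_smul_cpow_ae_eq {a r : ℝ} (ha : 0 < a) (hr : 0 < r) (s : ℂ) :
    (fun x : ℝ => (gammaPDF a r x).toReal • (x : ℂ) ^ (-s)) =ᵐ[volume]
      (Set.Ioi (0 : ℝ)).indicator fun x : ℝ => (((r ^ a / Real.Gamma a : ℝ)) : ℂ) *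
        ((x : ℂ) ^ (a - s - 1) * Complex.exp (-(r * x))) := by
  -- The origin is discarded: the two sides can differ there, for instance when a = 1 and s = 0.
  filter_upwards [compl_mem_ae_iff.2 (measure_singleton (0 : ℝ))] with x hx
  rcases lt_or_gt_of_ne (show x ≠ 0 from hx) with h | h
  · rw [gammaPDF_of_neg h, Set.indicator_of_notMem (by simp [h.le])]
    simp
  · have hx0 : (x : ℂ) ≠ 0 := by exact_mod_cast h.ne'
    rw [Set.indicator_of_mem (show x ∈ Set.Ioi (0 : ℝ) from h), gammaPDF_of_nonneg h.le,
      ENNReal.toReal_ofReal (by have := Real.Gamma_pos_of_pos ha; positivity), Complex.real_smul,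
      show (a : ℂ) - s - 1 = ((a - 1 : ℝ) : ℂ) + -s by push_cast; ring,
      Complex.cpow_add _ _ hx0, ← Complex.ofReal_cpow h.le]
    push_cast
    ring

/-- The complex moments of the Gamma law: integrability. -/
theorem integrable_cpow_neg_gammaMeasure {a r : ℝ} (ha : 0 < a) (hr : 0 < r) {s : ℂ}
    (hs : s.re < a) : Integrable (fun x : ℝ => (x : ℂ) ^ (-s)) (gammaMeasure a r) := by
  rw [gammaMeasure, integrable_withDensity_iff_integrable_smul'
    (measurable_gammaPDF a r) (.of_forall fun x => ENNReal.ofReal_lt_top),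
    integrable_congr (gammaPDF_toReal_smul_cpow_ae_eq ha hr s),
    integrable_indicator_iff measurableSet_Ioi]
  -- A non-integrable function has integral 0 by convention, so the nonzero closed form of the
  -- integral already proves integrability.
  refine Integrable.const_mul (Integrable.of_integral_ne_zero ?_) _
  have h : 0 < ((a : ℂ) - s).re := by simpa using hs
  rw [Complex.integral_cpow_mul_exp_neg_mul_Ioi h hr]
  refine mul_ne_zero ?_ (Complex.Gamma_ne_zero_of_re_pos h)
  rw [Complex.cpow_ne_zero_iff]
  exact .inl (by simpa using hr.ne')

/-- The complex moments of the Gamma law. -/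
theorem integral_cpow_neg_gammaMeasure {a r : ℝ} (ha : 0 < a) (hr : 0 < r) {s : ℂ}
    (hs : s.re < a) : ∫ x : ℝ, (x : ℂ) ^ (-s) ∂gammaMeasure a r =
      (r : ℂ) ^ s * Complex.Gamma (a - s) / Real.Gamma a := by
  have h : 0 < ((a : ℂ) - s).re := by simpa using hs
  have hr0 : (r : ℂ) ≠ 0 := by exact_mod_cast hr.ne'
  rw [gammaMeasure, integral_withDensity_eq_integral_toReal_smul
    (measurable_gammaPDF a r) (.of_forall fun x => ENNReal.ofReal_lt_top),
    integral_congr_ae (gammaPDF_toReal_smul_cpow_ae_eq ha hr s),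
    integral_indicator measurableSet_Ioi, integral_const_mul,
    Complex.integral_cpow_mul_exp_neg_mul_Ioi h hr, one_div,
    Complex.inv_cpow _ _ (by rw [Complex.arg_ofReal_of_nonneg hr.le]; exact Real.pi_ne_zero.symm),
    Complex.cpow_sub _ _ hr0]
  push_cast [Complex.ofReal_cpow hr.le]
  have h1 : (r : ℂ) ^ (a : ℂ) ≠ 0 := by simp [hr0]
  have h2 : (r : ℂ) ^ s ≠ 0 := by simp [hr0]
  field_simp

theorem gammaMeasure_singleton (a r x : ℝ) : gammaMeasure a r {x} = 0 :=
  withDensity_absolutelyContinuous _ _ (measure_singleton x)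

theorem ae_pos_gammaMeasure (a r : ℝ) : ∀ᵐ x ∂gammaMeasure a r, 0 < x := by
  have h : gammaMeasure a r (Set.Iio 0) = 0 := by
    rw [gammaMeasure, withDensity_apply _ measurableSet_Iio, lintegral_gammaPDF_of_nonpos le_rfl]
  have h0 := gammaMeasure_singleton a r 0
  filter_upwards [measure_eq_zero_iff_ae_notMem.1 h, measure_eq_zero_iff_ae_notMem.1 h0]
    with x h1 h2
  exact lt_of_le_of_ne (by simpa using h1) (Ne.symm (by simpa using h2))

end ProbabilityTheory

/-! ### Mellin inversion of a distribution function -/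

/-- The integrand of the Mellin transform of `x ↦ ρ {y | x * y ≤ 1}`, before the integration
over `y`. -/
theorem cpow_mul_indicator_eq {y : ℝ} (hy : 0 < y) (s : ℂ) (x : ℝ) :
    (x : ℂ) ^ (s - 1) * {p : ℝ × ℝ | p.1 * p.2 ≤ 1}.indicator (fun _ => (1 : ℂ)) (x, y) =
      (Set.Iic y⁻¹).indicator (fun x : ℝ => (x : ℂ) ^ (s - 1)) x := by
  have : (x, y) ∈ {p : ℝ × ℝ | p.1 * p.2 ≤ 1} ↔ x ∈ Set.Iic y⁻¹ := by
    rw [Set.mem_Iic, ← one_div, le_div_iff₀ hy]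
    rfl
  by_cases h : x ∈ Set.Iic y⁻¹
  · rw [Set.indicator_of_mem h, Set.indicator_of_mem (this.2 h), mul_one]
  · rw [Set.indicator_of_notMem h, Set.indicator_of_notMem (fun h' => h (this.1 h')), mul_zero]

/-- For fixed y > 0 the norm integrates over 0 < x ≤ 1/y to y^(-Re s)/Re s, which is ρ-integrable by
the moment hypothesis. This justifies Fubini in the Mellin transform. -/
theorem integrable_cpow_mul_indicator {ρ : Measure ℝ} [IsFiniteMeasure ρ]
    (hpos : ∀ᵐ y ∂ρ, 0 < y) {s : ℂ} (hs : 0 < s.re)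
    (hint : Integrable (fun y : ℝ => (y : ℂ) ^ (-s)) ρ) :
    Integrable (fun p : ℝ × ℝ => (p.1 : ℂ) ^ (s - 1) *
      {p : ℝ × ℝ | p.1 * p.2 ≤ 1}.indicator (fun _ => (1 : ℂ)) p)
      ((volume.restrict (Set.Ioi 0)).prod ρ) := by
  have hm : Measurable (fun p : ℝ × ℝ => (p.1 : ℂ) ^ (s - 1) *
      {p : ℝ × ℝ | p.1 * p.2 ≤ 1}.indicator (fun _ => (1 : ℂ)) p) := by
    refine Measurable.mul (by fun_prop) (measurable_const.indicator ?_)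
    exact measurableSet_le (by fun_prop) measurable_const
  rw [integrable_prod_iff' hm.aestronglyMeasurable]
  have h1 : -1 < (s - 1).re := by simpa using hs
  constructor
  · filter_upwards [hpos] with y hy
    simp only [cpow_mul_indicator_eq hy]
    rw [integrable_indicator_iff measurableSet_Iic, IntegrableOn, Measure.restrict_restrict
      measurableSet_Iic, Set.Iic_inter_Ioi]
    have := intervalIntegral.intervalIntegrable_cpow' (a := 0) (b := y⁻¹) h1
    rwa [intervalIntegrable_iff_integrableOn_Ioc_of_le (by positivity)] at this
  · refine (hint.norm.div_const s.re).congr ?_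
    filter_upwards [hpos] with y hy
    simp only [cpow_mul_indicator_eq hy, norm_indicator_eq_indicator_norm]
    rw [integral_indicator measurableSet_Iic, Measure.restrict_restrict measurableSet_Iic,
      Set.Iic_inter_Ioi]
    have h2 : ∫ x in Set.Ioc 0 y⁻¹, ‖(x : ℂ) ^ (s - 1)‖ =
        ∫ x in Set.Ioc 0 y⁻¹, x ^ (s.re - 1) := by
      refine setIntegral_congr_fun measurableSet_Ioc fun x hx => ?_
      simp [Complex.norm_cpow_eq_rpow_re_of_pos hx.1]
    rw [h2, ← intervalIntegral.integral_of_le (by positivity),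
      integral_rpow (.inl (by linarith)), Complex.norm_cpow_eq_rpow_re_of_pos hy]
    simp only [Complex.neg_re, sub_add_cancel, Real.zero_rpow hs.ne', sub_zero]
    rw [Real.inv_rpow hy.le, Real.rpow_neg hy.le]

theorem mellinConvergent_integral_indicator {ρ : Measure ℝ} [IsFiniteMeasure ρ]
    (hpos : ∀ᵐ y ∂ρ, 0 < y) {s : ℂ} (hs : 0 < s.re)
    (hint : Integrable (fun y : ℝ => (y : ℂ) ^ (-s)) ρ) :
    MellinConvergent (fun x => ∫ y, {p : ℝ × ℝ | p.1 * p.2 ≤ 1}.indicator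
      (fun _ => (1 : ℂ)) (x, y) ∂ρ) s := by
  have h := (integrable_cpow_mul_indicator hpos hs hint).integral_prod_left
  simp only [integral_const_mul] at h
  exact h

/-- The Mellin transform of `x ↦ ρ {y | x * y ≤ 1}` is `s⁻¹` times the moment of order `-s`. -/
theorem mellin_integral_indicator {ρ : Measure ℝ} [IsFiniteMeasure ρ]
    (hpos : ∀ᵐ y ∂ρ, 0 < y) {s : ℂ} (hs : 0 < s.re)
    (hint : Integrable (fun y : ℝ => (y : ℂ) ^ (-s)) ρ) :
    mellin (fun x => ∫ y, {p : ℝ × ℝ | p.1 * p.2 ≤ 1}.indicator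
      (fun _ => (1 : ℂ)) (x, y) ∂ρ) s = (∫ y : ℝ, (y : ℂ) ^ (-s) ∂ρ) / s := by
  have h1 : -1 < (s - 1).re := by simpa using hs
  have hs0 : s ≠ 0 := by rintro rfl; simp at hs
  simp only [mellin, smul_eq_mul]
  simp_rw [← integral_const_mul]
  rw [integral_integral_swap (integrable_cpow_mul_indicator hpos hs hint), ← integral_div]
  refine integral_congr_ae ?_
  filter_upwards [hpos] with y hy
  simp only [cpow_mul_indicator_eq hy]
  rw [integral_indicator measurableSet_Iic, Measure.restrict_restrict measurableSet_Iic,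
    Set.Iic_inter_Ioi, ← intervalIntegral.integral_of_le (by positivity),
    integral_cpow (.inl h1)]
  simp only [sub_add_cancel, Complex.ofReal_zero, Complex.zero_cpow hs0, sub_zero]
  rw [Complex.ofReal_inv, Complex.inv_cpow _ _
    (by rw [Complex.arg_ofReal_of_nonneg hy.le]; exact Real.pi_ne_zero.symm), Complex.cpow_neg]

/-- Dominated convergence: at x = 1/w the indicator jumps only for y = w, a ρ-null point. -/
theorem continuousAt_integral_indicator {ρ : Measure ℝ} [IsFiniteMeasure ρ] {w : ℝ}
    (hw : 0 < w) (hatom : ρ {w} = 0) :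
    ContinuousAt (fun x => ∫ y, {p : ℝ × ℝ | p.1 * p.2 ≤ 1}.indicator
      (fun _ => (1 : ℂ)) (x, y) ∂ρ) w⁻¹ := by
  have hm : MeasurableSet {p : ℝ × ℝ | p.1 * p.2 ≤ 1} :=
    measurableSet_le (by fun_prop) measurable_const
  refine continuousAt_of_dominated (bound := fun _ => 1) (.of_forall fun x => ?_)
    (.of_forall fun x => .of_forall fun y => ?_) (integrable_const 1) ?_
  · exact ((measurable_const.indicator hm).comp measurable_prodMk_left).aestronglyMeasurable
  · exact (norm_indicator_le_norm_self _ _).trans (by simp)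
  · filter_upwards [measure_eq_zero_iff_ae_notMem.1 hatom] with y hy
    have hne : w⁻¹ * y ≠ 1 := fun h => hy (by
      rw [inv_mul_eq_one₀ hw.ne'] at h; simp [h])
    have hc : ContinuousAt (fun x : ℝ => x * y) w⁻¹ := by fun_prop
    rcases lt_or_gt_of_ne hne with h | h
    · refine (continuousAt_const (y := (1 : ℂ))).congr ?_
      filter_upwards [hc.eventually (gt_mem_nhds h)] with x hx
      rw [Set.indicator_of_mem (show (x, y) ∈ {p : ℝ × ℝ | p.1 * p.2 ≤ 1} from hx.le)]
    · refine (continuousAt_const (y := (0 : ℂ))).congr ?_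
      filter_upwards [hc.eventually (lt_mem_nhds h)] with x hx
      rw [Set.indicator_of_notMem (show (x, y) ∉ {p : ℝ × ℝ | p.1 * p.2 ≤ 1} from not_le.2 hx)]

/-- The distribution function of a law on the positive half-line, recovered from its complex
moments by Mellin inversion. -/
theorem integral_moment_mul_cpow_eq_measureReal_Iic {ρ : Measure ℝ} [IsFiniteMeasure ρ]
    (hpos : ∀ᵐ y ∂ρ, 0 < y) {σ : ℝ} (hσ : 0 < σ)
    (hint : ∀ t : ℝ, Integrable (fun y : ℝ => (y : ℂ) ^ (-(σ + t * Complex.I))) ρ)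
    (hvert : Complex.VerticalIntegrable (fun s => (∫ y : ℝ, (y : ℂ) ^ (-s) ∂ρ) / s) σ)
    {w : ℝ} (hw : 0 < w) (hatom : ρ {w} = 0) :
    (1 / (2 * (Real.pi : ℂ))) * ∫ t : ℝ,
      (∫ y : ℝ, (y : ℂ) ^ (-(σ + t * Complex.I)) ∂ρ) / (σ + t * Complex.I) *
        (w : ℂ) ^ (σ + t * Complex.I) = ρ.real (Set.Iic w) := by
  have hre (t : ℝ) : 0 < ((σ : ℂ) + t * Complex.I).re := by simpa using hσ
  have hM (t : ℝ) := mellin_integral_indicator hpos (hre t) (hint t)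
  -- The inverse transform carries x^(-s), so evaluating it at x = 1/w produces the factor w^s.
  have h := mellinInv_mellin_eq σ _ (inv_pos.2 hw)
    (mellinConvergent_integral_indicator hpos (by simpa using hσ) (by simpa using hint 0))
    (by
      refine hvert.congr (.of_forall fun t => ?_)
      exact (hM t).symm)
    (continuousAt_integral_indicator hw hatom)
  simp only [mellinInv, hM] at h
  have hS : ∫ y, {p : ℝ × ℝ | p.1 * p.2 ≤ 1}.indicator (fun _ => (1 : ℂ)) (w⁻¹, y) ∂ρ =
      ρ.real (Set.Iic w) := by
    have h2 (y : ℝ) : {p : ℝ × ℝ | p.1 * p.2 ≤ 1}.indicator (fun _ => (1 : ℂ)) (w⁻¹, y) =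
        (Set.Iic w).indicator (fun _ => (1 : ℂ)) y := by
      have : (w⁻¹, y) ∈ {p : ℝ × ℝ | p.1 * p.2 ≤ 1} ↔ y ∈ Set.Iic w := by
        simp [inv_mul_le_iff₀ hw]
      simp only [Set.indicator, this]
    simp only [h2]
    rw [integral_indicator measurableSet_Iic]
    simp
  rw [hS] at h
  rw [← h, Complex.real_smul]
  push_cast
  congr 1
  refine integral_congr_ae (.of_forall fun t => ?_)
  simp only [smul_eq_mul]
  rw [Complex.inv_cpow _ _
    (by rw [Complex.arg_ofReal_of_nonneg hw.le]; exact Real.pi_ne_zero.symm), Complex.cpow_neg,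
    inv_inv, mul_comm]

/-! ### Layer-cake formula for the logarithm -/

/-- The layer-cake formula for `log (1 + Z)`, with both sides finite. -/
theorem integral_log_one_add_eq_integral_tail {Ω : Type*} [MeasurableSpace Ω] {μ : Measure Ω}
    [IsFiniteMeasure μ] {Z : Ω → ℝ} (hZ : 0 ≤ᵐ[μ] Z) (hint : Integrable Z μ) :
    Integrable (fun ω => Real.log (1 + Z ω)) μ ∧
    IntegrableOn (fun z => 1 / (z + 1) * μ.real {ω | z < Z ω}) (Set.Ioi 0) ∧
    ∫ ω, Real.log (1 + Z ω) ∂μ =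
      ∫ z in Set.Ioi (0 : ℝ), 1 / (z + 1) * μ.real {ω | z < Z ω} := by
  have hlog : Integrable (fun ω => Real.log (1 + Z ω)) μ := by
    refine hint.mono' ?_ ?_
    · exact (Real.measurable_log.comp_aemeasurable
        (hint.aemeasurable.const_add 1)).aestronglyMeasurable
    · filter_upwards [hZ] with ω hω
      have hω : 0 ≤ Z ω := hω
      rw [Real.norm_of_nonneg (Real.log_nonneg (by linarith))]
      linarith [Real.log_le_sub_one_of_pos (show 0 < 1 + Z ω by linarith)]
  have hlc := lintegral_comp_eq_lintegral_meas_lt_mul μ hZ hint.aemeasurable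
    (g := fun t => 1 / (t + 1))
    (fun t ht => ContinuousOn.intervalIntegrable (by
      rw [Set.uIcc_of_le ht.le]
      refine ContinuousOn.div (by fun_prop) (by fun_prop) fun x hx => ?_
      linarith [hx.1]))
    (by
      filter_upwards [self_mem_ae_restrict measurableSet_Ioi] with t ht
      have : (0 : ℝ) < t := ht
      positivity)
  have hL : ∫⁻ ω, ENNReal.ofReal (∫ t in (0 : ℝ)..Z ω, 1 / (t + 1)) ∂μ =
      ∫⁻ ω, ENNReal.ofReal (Real.log (1 + Z ω)) ∂μ := by
    refine lintegral_congr_ae ?_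
    filter_upwards [hZ] with ω hω
    have hω : 0 ≤ Z ω := hω
    simp only [one_div]
    rw [intervalIntegral.integral_comp_add_right (fun t : ℝ => t⁻¹) 1,
      integral_inv_of_pos (by norm_num) (by linarith)]
    simp [add_comm]
  have hnn : 0 ≤ᵐ[μ] fun ω => Real.log (1 + Z ω) := by
    filter_upwards [hZ] with ω hω
    have hω : 0 ≤ Z ω := hω
    exact Real.log_nonneg (by linarith)
  have hR : (fun z : ℝ => 1 / (z + 1) * μ.real {ω | z < Z ω}) =ᵐ[volume.restrict (Set.Ioi 0)]
      fun z => (μ {ω | z < Z ω} * ENNReal.ofReal (1 / (z + 1))).toReal := by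
    filter_upwards [self_mem_ae_restrict measurableSet_Ioi] with z hz
    have hz : (0 : ℝ) < z := hz
    rw [ENNReal.toReal_mul, ENNReal.toReal_ofReal (by positivity), mul_comm, Measure.real]
  have hm : AEMeasurable (fun z : ℝ => μ {ω | z < Z ω} * ENNReal.ofReal (1 / (z + 1)))
      (volume.restrict (Set.Ioi 0)) := by
    refine AEMeasurable.mul (Antitone.measurable ?_).aemeasurable (by fun_prop)
    exact fun a b hab => measure_mono fun ω hω => lt_of_le_of_lt hab hω
  have hfin : ∫⁻ z in Set.Ioi (0 : ℝ), μ {ω | z < Z ω} * ENNReal.ofReal (1 / (z + 1)) ≠ ⊤ := by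
    rw [← hlc, hL]
    exact ((hasFiniteIntegral_iff_ofReal hnn).1 hlog.2).ne
  refine ⟨hlog, ?_, ?_⟩
  · exact (integrable_toReal_of_lintegral_ne_top hm hfin).congr hR.symm
  · rw [integral_congr_ae hR, integral_toReal hm (ae_lt_top' hm hfin), ← hlc, hL,
      integral_eq_lintegral_of_nonneg_ae hnn hlog.1]

/-! ### Product of two independent Gamma variables -/

section GammaProduct

variable {Ω : Type*} [MeasurableSpace Ω] {μ : Measure Ω} {a r : ℝ} {X Y : Ω → ℝ}

theorem ae_pos_map_mul_of_hasLaw_gammaMeasure (hX : HasLaw X (gammaMeasure a r) μ)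
    (hY : HasLaw Y (gammaMeasure a r) μ) :
    ∀ᵐ y ∂μ.map (fun ω => X ω * Y ω), 0 < y := by
  rw [ae_map_iff (hX.aemeasurable.fun_mul hY.aemeasurable) measurableSet_Ioi]
  have hm : Measurable fun x : ℝ => 0 < x := measurableSet_setOfPred.1 measurableSet_Ioi
  filter_upwards [(hX.ae_iff hm).2 (ae_pos_gammaMeasure a r),
    (hY.ae_iff hm).2 (ae_pos_gammaMeasure a r)] with ω h1 h2
  exact mul_pos h1 h2

theorem map_mul_singleton_of_hasLaw_gammaMeasure [IsProbabilityMeasure μ]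
    (hX : HasLaw X (gammaMeasure a r) μ) (hY : HasLaw Y (gammaMeasure a r) μ)
    (hXY : IndepFun X Y μ) (w : ℝ) :
    μ.map (fun ω => X ω * Y ω) {w} = 0 := by
  have : IsProbabilityMeasure (gammaMeasure a r) := hX.isProbabilityMeasure_iff.1 inferInstance
  have hs : MeasurableSet {p : ℝ × ℝ | p.1 * p.2 = w} :=
    measurableSet_eq_fun (by fun_prop) measurable_const
  have hprod := (indepFun_iff_map_prod_eq_prod_map_map hX.aemeasurable hY.aemeasurable).1 hXY
  rw [hX.map_eq, hY.map_eq] at hprod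
  have h0 : (gammaMeasure a r).prod (gammaMeasure a r) {p : ℝ × ℝ | p.1 * p.2 = w} = 0 := by
    rw [Measure.measure_prod_null hs]
    -- For x > 0 the slice of {xy = w} is the single point w/x, which is null for the Gamma law.
    filter_upwards [ae_pos_gammaMeasure a r] with x hx
    refine measure_mono_null (fun y hy => ?_) (gammaMeasure_singleton a r (w / x))
    have hy : x * y = w := hy
    rw [Set.mem_singleton_iff, ← hy]
    field_simp
  rw [← hprod, Measure.map_apply_of_aemeasurable
    (hX.aemeasurable.prodMk hY.aemeasurable) hs] at h0
  rw [Measure.map_apply_of_aemeasurable (hX.aemeasurable.fun_mul hY.aemeasurable)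
    (measurableSet_singleton w)]
  exact h0

theorem ofReal_mul_cpow_ae_eq (hX : HasLaw X (gammaMeasure a r) μ)
    (hY : HasLaw Y (gammaMeasure a r) μ) (s : ℂ) :
    (fun ω => ((X ω * Y ω : ℝ) : ℂ) ^ s) =ᵐ[μ]
      (fun ω => (X ω : ℂ) ^ s) * fun ω => (Y ω : ℂ) ^ s := by
  have hm : Measurable fun x : ℝ => 0 < x := measurableSet_setOfPred.1 measurableSet_Ioi
  filter_upwards [(hX.ae_iff hm).2 (ae_pos_gammaMeasure a r),
    (hY.ae_iff hm).2 (ae_pos_gammaMeasure a r)] with ω h1 h2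
  rw [Complex.ofReal_mul, Complex.mul_cpow_ofReal_nonneg h1.le h2.le]
  rfl

theorem integrable_cpow_neg_of_hasLaw_gammaMeasure (ha : 0 < a) (hr : 0 < r)
    (hX : HasLaw X (gammaMeasure a r) μ) {s : ℂ} (hs : s.re < a) :
    Integrable (fun ω => (X ω : ℂ) ^ (-s)) μ := by
  have h := integrable_cpow_neg_gammaMeasure ha hr hs
  rw [← hX.map_eq] at h
  exact h.comp_aemeasurable hX.aemeasurable

theorem integrable_mul_cpow_neg_of_hasLaw_gammaMeasure (ha : 0 < a) (hr : 0 < r)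
    (hX : HasLaw X (gammaMeasure a r) μ) (hY : HasLaw Y (gammaMeasure a r) μ)
    (hXY : IndepFun X Y μ) {s : ℂ} (hs : s.re < a) :
    Integrable (fun ω => ((X ω * Y ω : ℝ) : ℂ) ^ (-s)) μ := by
  have hm : Measurable fun x : ℝ => (x : ℂ) ^ (-s) := by fun_prop
  exact ((hXY.comp hm hm).integrable_mul
    (integrable_cpow_neg_of_hasLaw_gammaMeasure ha hr hX hs)
    (integrable_cpow_neg_of_hasLaw_gammaMeasure ha hr hY hs)).congr
    (ofReal_mul_cpow_ae_eq hX hY (-s)).symm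

/-- The complex moments of a product of two independent Gamma variables. -/
theorem integral_mul_cpow_neg_of_hasLaw_gammaMeasure (ha : 0 < a) (hr : 0 < r)
    (hX : HasLaw X (gammaMeasure a r) μ) (hY : HasLaw Y (gammaMeasure a r) μ)
    (hXY : IndepFun X Y μ) {s : ℂ} (hs : s.re < a) :
    ∫ ω, ((X ω * Y ω : ℝ) : ℂ) ^ (-s) ∂μ =
      ((r : ℂ) ^ s * Complex.Gamma (a - s) / Real.Gamma a) ^ 2 := by
  have hm : Measurable fun x : ℝ => (x : ℂ) ^ (-s) := by fun_prop
  have hmom (Z : Ω → ℝ) (hZ : HasLaw Z (gammaMeasure a r) μ) :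
      ∫ ω, (Z ω : ℂ) ^ (-s) ∂μ = (r : ℂ) ^ s * Complex.Gamma (a - s) / Real.Gamma a := by
    rw [← integral_cpow_neg_gammaMeasure ha hr hs]
    exact hZ.integral_comp (f := fun x : ℝ => (x : ℂ) ^ (-s)) hm.aestronglyMeasurable
  rw [integral_congr_ae (ofReal_mul_cpow_ae_eq hX hY (-s))]
  have := (hXY.comp hm hm).integral_mul_eq_mul_integral
    (integrable_cpow_neg_of_hasLaw_gammaMeasure ha hr hX hs).1
    (integrable_cpow_neg_of_hasLaw_gammaMeasure ha hr hY hs).1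
  refine this.trans ?_
  simp only [Function.comp_def]
  rw [hmom X hX, hmom Y hY, sq]

theorem integrable_mul_of_hasLaw_gammaMeasure (ha : 0 < a) (hr : 0 < r)
    (hX : HasLaw X (gammaMeasure a r) μ) (hY : HasLaw Y (gammaMeasure a r) μ)
    (hXY : IndepFun X Y μ) : Integrable (fun ω => X ω * Y ω) μ := by
  -- The first moment is the case s = -1, allowed because -1 < a.
  have := (integrable_mul_cpow_neg_of_hasLaw_gammaMeasure ha hr hX hY hXY (s := -1)
    (by simp; linarith)).re
  simpa using this

/-- The distribution function of a product of two independent Gamma variables is a Meijer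
G function. -/
theorem meijerG_eq_measureReal_mul_le [IsProbabilityMeasure μ] (ha : 0 < a) (hr : 0 < r)
    (hX : HasLaw X (gammaMeasure a r) μ) (hY : HasLaw Y (gammaMeasure a r) μ)
    (hXY : IndepFun X Y μ) {w : ℝ} (hw : 0 < w) :
    meijerG [1] [] [(a : ℂ), (a : ℂ)] [0] ((r ^ 2 * w : ℝ) : ℂ) / (Real.Gamma a : ℂ) ^ 2 =
      μ.real {ω | X ω * Y ω ≤ w} := by
  have hW : AEMeasurable (fun ω => X ω * Y ω) μ := hX.aemeasurable.mul hY.aemeasurable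
  have hex : ∃ σ : ℝ, MeijerSeparates [1] [(a : ℂ), (a : ℂ)] σ :=
    ⟨a / 2, by simp [MeijerSeparates, ha]⟩
  rw [meijerG, dif_pos hex]
  obtain ⟨hσ, hσa⟩ : 0 < hex.choose ∧ hex.choose < a := by
    simpa [MeijerSeparates] using hex.choose_spec
  generalize hex.choose = σ at hσ hσa ⊢
  have hre (t : ℝ) : ((σ : ℂ) + t * Complex.I).re < a := by simpa using hσa
  have hs0 (t : ℝ) : (σ : ℂ) + t * Complex.I ≠ 0 := fun h => by
    have := congrArg Complex.re h
    simp at this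
    linarith
  have hmeas (s : ℂ) : AEStronglyMeasurable (fun y : ℝ => (y : ℂ) ^ (-s))
      (μ.map fun ω => X ω * Y ω) := by
    have hm : Measurable fun x : ℝ => (x : ℂ) ^ (-s) := by fun_prop
    exact hm.aestronglyMeasurable
  have hmom (t : ℝ) : ∫ y : ℝ, (y : ℂ) ^ (-(σ + t * Complex.I)) ∂μ.map (fun ω => X ω * Y ω) =
      ((r : ℂ) ^ (σ + t * Complex.I) * Complex.Gamma (a - (σ + t * Complex.I)) /
        Real.Gamma a) ^ 2 := by
    rw [integral_map hW (hmeas _),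
      integral_mul_cpow_neg_of_hasLaw_gammaMeasure ha hr hX hY hXY (hre t)]
  have : IsProbabilityMeasure (μ.map fun ω => X ω * Y ω) := Measure.isProbabilityMeasure_map hW
  have key := integral_moment_mul_cpow_eq_measureReal_Iic
    (ae_pos_map_mul_of_hasLaw_gammaMeasure hX hY) hσ
    (fun t => (integrable_map_measure (hmeas _) hW).2
      (integrable_mul_cpow_neg_of_hasLaw_gammaMeasure ha hr hX hY hXY (hre t)))
    (by
      refine ((verticalIntegrable_cpow_mul_Gamma_sq_div hr hσ hσa).div_const
        ((Real.Gamma a : ℂ) ^ 2)).congr (.of_forall fun t => ?_)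
      simp only [hmom]
      ring)
    hw (map_mul_singleton_of_hasLaw_gammaMeasure hX hY hXY w)
  rw [map_measureReal_apply_of_aemeasurable hW measurableSet_Iic] at key
  refine Eq.trans ?_ key
  rw [mul_div_assoc, ← integral_div]
  congr 1
  refine integral_congr_ae (.of_forall fun t => ?_)
  simp only [hmom]
  generalize hs : (σ : ℂ) + t * Complex.I = s
  have hs0' : s ≠ 0 := hs ▸ hs0 t
  have h1 : Complex.Gamma s ≠ 0 := Complex.Gamma_ne_zero_of_re_pos (by rw [← hs]; simpa using hσ)
  rw [Complex.ofReal_mul, Complex.mul_cpow_ofReal_nonneg (by positivity) hw.le,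
    Complex.ofReal_pow, sq (r : ℂ), Complex.mul_cpow_ofReal_nonneg hr.le hr.le]
  -- Γ(1 + s) = s Γ(s) reduces the quotient Γ(s)/Γ(1 + s) in the kernel to 1/s.
  simp only [meijerKernel, List.map_cons, List.map_nil, List.prod_cons, List.prod_nil, sub_self,
    zero_add, mul_one, sub_zero, add_comm (1 : ℂ) s, Complex.Gamma_add_one s hs0']
  field_simp

end GammaProduct

/-! ### The ergodic radar rate -/

theorem RadarSystem.Xi_pos (S : RadarSystem) : 0 < S.Xi := by
  obtain ⟨h1, h2, h3, h4, h5, h6, h7, h8⟩ := And.intro S.T_pos <| And.intro S.B_pos <|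
    And.intro S.β_pos <| And.intro S.PBS_pos <| And.intro S.σRCS_pos <|
    And.intro S.wavelength_pos <| And.intro S.γ_pos S.στ_pos
  have h9 := S.kB_pos
  have h10 := S.Temp_pos
  unfold Xi Cr noisePower
  positivity

theorem theorem2 {Ω : Type*} [MeasurableSpace Ω] (μ : Measure Ω) [IsProbabilityMeasure μ]
    (S : RadarSystem) (m : ℝ) (hm : 0 < m) (hd hu : Ω → ℂ)
    (hd_law : IsNakagami μ m hd) (hu_law : IsNakagami μ m hu)
    (h_indep : IndepFun (fun ω => ‖hd ω‖ ^ 2) (fun ω => ‖hu ω‖ ^ 2) μ) :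
    Integrable (fun ω => S.reir (hd ω) (hu ω)) μ ∧
    IntegrableOn (fun z : ℝ => (1 / ((z : ℂ) + 1)) *
        (1 - meijerG [1] [] [(m : ℂ), (m : ℂ)] [0]
          ((m ^ 2 * S.d ^ S.α / S.Xi * z : ℝ) : ℂ) / ((Real.Gamma m : ℂ) ^ 2)))
      (Set.Ioi 0) ∧
    (S.ergodicREIR μ hd hu : ℂ) =
      ((S.δ / (2 * S.T * Real.log 2) : ℝ) : ℂ) *
        ∫ z in Set.Ioi (0 : ℝ), (1 / ((z : ℂ) + 1)) *
          (1 - meijerG [1] [] [(m : ℂ), (m : ℂ)] [0]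
            ((m ^ 2 * S.d ^ S.α / S.Xi * z : ℝ) : ℂ) / ((Real.Gamma m : ℂ) ^ 2)) := by
  set c : ℝ := S.Xi * S.d ^ (-S.α) with hc_def
  have hXi := S.Xi_pos
  have hc : 0 < c := mul_pos hXi (Real.rpow_pos_of_pos S.d_pos _)
  have hW : Integrable (fun ω => ‖hd ω‖ ^ 2 * ‖hu ω‖ ^ 2) μ :=
    integrable_mul_of_hasLaw_gammaMeasure hm hm hd_law hu_law h_indep
  obtain ⟨hlog, htail, heq⟩ := integral_log_one_add_eq_integral_tail (μ := μ)
    (Z := fun ω => c * (‖hd ω‖ ^ 2 * ‖hu ω‖ ^ 2)) (.of_forall fun ω => by positivity)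
    (hW.const_mul c)
  have hreir (ω : Ω) : S.reir (hd ω) (hu ω) = S.δ / (2 * S.T * Real.log 2) *
      Real.log (1 + c * (‖hd ω‖ ^ 2 * ‖hu ω‖ ^ 2)) := by
    rw [RadarSystem.reir, S.echoSNR_eq_Xi, Real.logb, ← hc_def]
    ring
  have hint : ∀ z ∈ Set.Ioi (0 : ℝ),
      ((1 / (z + 1) * μ.real {ω | z < c * (‖hd ω‖ ^ 2 * ‖hu ω‖ ^ 2)} : ℝ) : ℂ) =
      (1 / ((z : ℂ) + 1)) * (1 - meijerG [1] [] [(m : ℂ), (m : ℂ)] [0]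
          ((m ^ 2 * S.d ^ S.α / S.Xi * z : ℝ) : ℂ) / ((Real.Gamma m : ℂ) ^ 2)) := by
    intro z hz
    have harg : m ^ 2 * S.d ^ S.α / S.Xi * z = m ^ 2 * (z / c) := by
      rw [hc_def, Real.rpow_neg S.d_pos.le]
      have := (Real.rpow_pos_of_pos S.d_pos S.α).ne'
      field_simp
    have hset : {ω | z < c * (‖hd ω‖ ^ 2 * ‖hu ω‖ ^ 2)} =
        {ω | ‖hd ω‖ ^ 2 * ‖hu ω‖ ^ 2 ≤ z / c}ᶜ := by
      ext ω
      simp [div_lt_iff₀' hc]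
    rw [harg, meijerG_eq_measureReal_mul_le hm hm hd_law hu_law h_indep (div_pos hz hc), hset,
      probReal_compl_eq_one_sub₀ (s := {ω | ‖hd ω‖ ^ 2 * ‖hu ω‖ ^ 2 ≤ z / c})
        (hW.aemeasurable.nullMeasurable measurableSet_Iic)]
    push_cast
    rfl
  refine ⟨?_, ?_, ?_⟩
  · simp only [hreir]
    exact hlog.const_mul _
  · exact IntegrableOn.congr_fun (Integrable.ofReal htail) hint measurableSet_Ioi
  · simp only [RadarSystem.ergodicREIR, hreir]
    rw [integral_const_mul, heq, ← setIntegral_congr_fun measurableSet_Ioi hint,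
      integral_complex_ofReal, Complex.ofReal_mul]
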